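/- Conventions. A *Polish ultrametric space* is a nonempty metric space $U$ whose metric is a complete ultrametric inducing a second-countable topology; its *distance set* is $\{d(x,y) : x,y\in U\}\setminus\{0\}$. The isometry group $\operatorname{Iso}(U)$ carries the topology of pointwise convergence. $U$ is *homogeneous* if $\operatorname{Iso}(U)$ acts transitively on $U$; it is *wide* if for every $r$ in its distance set $U$ contains infinitely many points that are pairwise at distance $r$; it is a *Polish ultrametric Urysohn space* if every isometric embedding of a finite subset of $U$ into $U$ extends to an isometry of $U$ onto itself, and every Polish ultrametric space whose distance set is contained in that of $U$ embeds isometrically into $U$. A *countable linear skeleton* $\langle\Delta,N\rangle$ is a nonempty countable linear order $\Delta$ with a map $\delta\mapsto N_\delta$ assigning to each $\delta\in\Delta$ a cardinal $1\le N_\delta\le\omega$, identified with the set of natural numbers below it; it is *maximal* if $N_\delta=\omega$ for all $\delta$, and *quasi-maximal* if $N_\delta\in\{1,\omega\}$ for all $\delta$. For $x\in\prod_{\delta}N_\delta$ write $x|_\delta$ for the restriction of $x$ to $\{\gamma:\gamma\ge\delta\}$ and $\operatorname{supp}(x)=\{\delta: x(\delta)\ne0\}$. Let $S^{\mathrm{Fin}}$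 be the set of all $x\in\prod_\delta N_\delta$ with finite support, and $S^{\mathrm{LF}}$ the set of all $x$ such that $\operatorname{supp}(x)\cap\{\gamma:\gamma\ge\delta\}$ is finite for every $\delta\in\Delta$. For $S\in\{S^{\mathrm{Fin}},S^{\mathrm{LF}}\}$ the generalized wreath product $\operatorname{Wr}^{S}_{\delta\in\Delta}\operatorname{Sym}(N_\delta)$ (written $\operatorname{Wr}^{\mathrm{Fin}}$, respectively $\operatorname{Wr}^{\mathrm{LF}}$) is the group of all permutations $g$ of $S$ such that for all $x,y\in S$ and $\delta\in\Delta$: (H1) $x|_\delta=y|_\delta$ if and only if $g(x)|_\delta=g(y)|_\delta$; (H2) the map $i\mapsto g(x^\delta_i)(\delta)$ is a permutation of $N_\delta$, where $x^\delta_i$ is any element of $S$ with $x^\delta_i(\delta)=i$ that agrees with $x$ on $\{\gamma:\gamma>\delta\}$. The topology $\tau$ on it is pointwise convergence with respect to the topology on $S$ generated by the sets $\{y\in S: y|_\gamma=x|_\gamma\}$ ($x\in\prod_\delta N_\delta$, $\gamma\in\Delta$); the topology $\tau^*$ is pointwise convergence with respect to the discrete topology on $S$. Theorem. Let $G$ be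 a topological group, and write $\cong$ for isomorphism of topological groups. The following are equivalent: 1. $G\cong\operatorname{Iso}(U)$ for some Polish ultrametric Urysohn space $U$; 2. $G\cong\operatorname{Iso}(U)$ for some homogeneous wide Polish ultrametric space $U$; 3. $G\cong\operatorname{Wr}^{\mathrm{LF}}_{\delta\in\Delta}\operatorname{Sym}(N_\delta)$, with the topology $\tau$, for some quasi-maximal countable linear skeleton $\langle\Delta,N\rangle$. Moreover, the following condition 4 holds if and only if conditions 1, 2, 3 hold and $G$ is nontrivial (so for nontrivial $G$ all four conditions are equivalent): 4. for some maximal countable linear skeleton $\langle\Delta,N\rangle$, either $G\cong\operatorname{Wr}^{\mathrm{LF}}_{\delta\in\Delta}\operatorname{Sym}(N_\delta)$ with the topology $\tau$, or $G\cong\operatorname{Wr}^{\mathrm{Fin}}_{\delta\in\Delta}\operatorname{Sym}(N_\delta)$ with the topology $\tau^*$. -/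

import Mathlib

/-!
Isometry groups of Polish ultrametric spaces, and generalized wreath products of full symmetric
groups over countable linear skeletons.
-/

namespace UltrametricWreath

/-! ### Topological isomorphism -/

/-- `G ≅ H` as topological groups, where `H` carries the topology `τ`. -/
def TopIso (G : Type*) [Group G] [TopologicalSpace G] (H : Type*) [Group H]
    (τ : TopologicalSpace H) : Prop :=
  Nonempty (G ≃ₜ* H)

/-! ### Polish ultrametric spaces -/

/-- A (nonempty) Polish ultrametric space: the metric is a complete ultrametric inducing a
second-countable topology. -/
structure IsPolishUltrametric (U : Type*) [MetricSpace U] : Prop where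
  nonempty : Nonempty U
  ultrametric : IsUltrametricDist U
  complete : CompleteSpace U
  secondCountable : SecondCountableTopology U

/-- The set of nonzero distances realized in `U`. -/
def distanceSet (U : Type*) [MetricSpace U] : Set ℝ :=
  {r | ∃ x y : U, dist x y = r} \ {0}

/-- The topology of pointwise convergence on the isometry group of `U`. -/
abbrev isoTopology (U : Type*) [MetricSpace U] : TopologicalSpace (U ≃ᵢ U) :=
  TopologicalSpace.induced (fun (ψ : U ≃ᵢ U) (x : U) => ψ x) inferInstance

/-- The isometry group acts transitively. -/
def IsHomogeneous (U : Type*) [MetricSpace U] : Prop :=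
  ∀ x y : U, ∃ ψ : U ≃ᵢ U, ψ x = y

/-- For each realized nonzero distance `r` there are infinitely many points which are pairwise at
distance `r`. -/
def IsWide (U : Type*) [MetricSpace U] : Prop :=
  ∀ r ∈ distanceSet U, ∃ x : ℕ → U, ∀ m n, m ≠ n → dist (x m) (x n) = r

/-- Every isometric embedding of a finite subset extends to an isometry of the whole space. -/
def IsUltrahomogeneous (U : Type*) [MetricSpace U] : Prop :=
  ∀ (s : Finset U) (f : s → U), Isometry f → ∃ ψ : U ≃ᵢ U, ∀ x : s, ψ x = f x

/-- Every Polish ultrametric space whose distances are among those of `U` embeds isometrically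
into `U`. (Polish spaces have at most continuum many points, so `Type` is large enough.) -/
def IsUniversal (U : Type*) [MetricSpace U] : Prop :=
  ∀ (X : Type) [MetricSpace X], IsPolishUltrametric X → distanceSet X ⊆ distanceSet U →
    ∃ f : X → U, Isometry f

/-- Polish ultrametric Urysohn spaces. -/
structure IsPolishUrysohn (U : Type*) [MetricSpace U] : Prop where
  polishUltrametric : IsPolishUltrametric U
  ultrahomogeneous : IsUltrahomogeneous U
  universal : IsUniversal U

/-! ### Generalized wreath products -/

section Wreath

variable {Δ : Type*} [PartialOrder Δ]

/-- The cardinal `N δ ≤ ω`, viewed as the set of all natural numbers below it. -/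
abbrev Coord (N : Δ → ℕ∞) (δ : Δ) : Type := {i : ℕ // (i : ℕ∞) < N δ}

/-- `x|_δ = y|_δ`: the sequences `x` and `y` agree on the cone above `δ`. -/
def AgreeFrom {N : Δ → ℕ∞} (δ : Δ) (x y : ∀ δ, Coord N δ) : Prop :=
  ∀ γ, δ ≤ γ → x γ = y γ

/-- The support of a sequence. -/
def supp {N : Δ → ℕ∞} (x : ∀ δ, Coord N δ) : Set Δ := {δ | (x δ : ℕ) ≠ 0}

/-- The domain of all sequences with support in the family `𝒜`. -/
def domainOf (N : Δ → ℕ∞) (𝒜 : Set (Set Δ)) : Set (∀ δ, Coord N δ) := {x | supp x ∈ 𝒜}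

/-- The finite subsets of `Δ`. -/
def FinSupp (Δ : Type*) : Set (Set Δ) := {A | A.Finite}

/-- The locally finite subsets of `Δ`: those with finitely many elements above each `δ`. -/
def LFSupp (Δ : Type*) [PartialOrder Δ] : Set (Set Δ) := {A | ∀ δ, (A ∩ {γ | δ ≤ γ}).Finite}

/-- The generalized wreath product of the permutation groups `H δ` over the domain `S`.
In the second condition `y` ranges over all perturbations of `x` at `δ`, i.e. the elements of `S`
which agree with `x` strictly above `δ`; the condition says that `y δ ↦ g y δ` is (given by) a
permutation in `H δ`. -/
def wreath {N : Δ → ℕ∞} (S : Set (∀ δ, Coord N δ))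
    (H : ∀ δ, Subgroup (Equiv.Perm (Coord N δ))) : Subgroup (Equiv.Perm S) where
  carrier := {g |
    (∀ (x y : S) (δ : Δ), AgreeFrom δ x.1 y.1 ↔ AgreeFrom δ (g x).1 (g y).1) ∧
    (∀ (x : S) (δ : Δ), ∃ σ ∈ H δ, ∀ y : S, (∀ γ, δ < γ → y.1 γ = x.1 γ) →
      (g y).1 δ = σ (y.1 δ))}
  one_mem' := ⟨fun _ _ _ => Iff.rfl, fun _ δ => ⟨1, (H δ).one_mem, fun _ _ => rfl⟩⟩
  mul_mem' := by
    rintro g h ⟨hg, hg'⟩ ⟨hh, hh'⟩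
    refine ⟨fun x y δ => (hh x y δ).trans (hg _ _ δ), fun x δ => ?_⟩
    obtain ⟨σ, hσ, hσ'⟩ := hh' x δ
    obtain ⟨ρ, hρ, hρ'⟩ := hg' (h x) δ
    refine ⟨ρ * σ, (H δ).mul_mem hρ hσ, fun y hy => ?_⟩
    have h1 := hρ' (h y) (fun γ hγ =>
      (hh y x γ).1 (fun ε hε => hy ε (hγ.trans_le hε)) γ le_rfl)
    rw [hσ' y hy] at h1
    exact h1
  inv_mem' := by
    rintro g ⟨hg, hg'⟩
    have hgg : ∀ x : S, g (g⁻¹ x) = x := fun x => g.apply_symm_apply x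
    have hinv : ∀ (x y : S) (δ : Δ), AgreeFrom δ x.1 y.1 ↔
        AgreeFrom δ (g⁻¹ x).1 (g⁻¹ y).1 := fun x y δ => by
      have := hg (g⁻¹ x) (g⁻¹ y) δ
      rw [hgg, hgg] at this
      exact this.symm
    refine ⟨hinv, fun x δ => ?_⟩
    obtain ⟨σ, hσ, hσ'⟩ := hg' (g⁻¹ x) δ
    refine ⟨σ⁻¹, (H δ).inv_mem hσ, fun y hy => ?_⟩
    have h1 := hσ' (g⁻¹ y) (fun γ hγ =>
      (hinv y x γ).1 (fun ε hε => hy ε (hγ.trans_le hε)) γ le_rfl)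
    rw [hgg] at h1
    rw [h1]
    exact (σ.symm_apply_apply _).symm

/-- The generalized wreath product of the full symmetric groups over the family `𝒜` of
admissible supports. -/
abbrev WrSym (N : Δ → ℕ∞) (𝒜 : Set (Set Δ)) : Subgroup (Equiv.Perm (domainOf N 𝒜)) :=
  wreath (domainOf N 𝒜) (fun _ => ⊤)

/-- The topology on sequences generated by the sets `{y | y|_γ = x|_γ}`. -/
abbrev coneTopology (N : Δ → ℕ∞) : TopologicalSpace (∀ δ, Coord N δ) :=
  TopologicalSpace.generateFrom {V | ∃ x γ, V = {y | AgreeFrom γ y x}}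

/-- The topology of pointwise convergence on a group of permutations of a space `(X, t)`. -/
abbrev pointwiseTopology {X : Type*} (t : TopologicalSpace X) (K : Subgroup (Equiv.Perm X)) :
    TopologicalSpace K :=
  TopologicalSpace.induced (fun (g : K) (x : X) => (g : Equiv.Perm X) x)
    (@Pi.topologicalSpace X (fun _ => X) (fun _ => t))

/-- The standard topology `τ` on the wreath product: pointwise convergence with respect to the
relative cone topology on the domain. -/
abbrev tau (N : Δ → ℕ∞) (𝒜 : Set (Set Δ)) : TopologicalSpace (WrSym N 𝒜) :=
  pointwiseTopology (TopologicalSpace.induced Subtype.val (coneTopology N)) (WrSym N 𝒜)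

/-- The topology `τ*` on the wreath product: pointwise convergence with respect to the
discrete topology on the domain. -/
abbrev tauStar (N : Δ → ℕ∞) (𝒜 : Set (Set Δ)) : TopologicalSpace (WrSym N 𝒜) :=
  pointwiseTopology ⊥ (WrSym N 𝒜)

end Wreath

/-! ### Countable linear skeletons -/

/-- A nonempty countable linear order labeled by nonzero cardinals `N δ ≤ ω` (with `ω` written
`⊤`). -/
structure CountableLinearSkeleton where
  Δ : Type
  [linearOrder : LinearOrder Δ]
  [countable : Countable Δ]
  [nonempty : Nonempty Δ]
  N : Δ → ℕ∞
  N_ne_zero : ∀ δ, N δ ≠ 0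

attribute [instance] CountableLinearSkeleton.linearOrder CountableLinearSkeleton.countable
  CountableLinearSkeleton.nonempty

/-- All labels are `ω`. -/
def CountableLinearSkeleton.IsMaximal (K : CountableLinearSkeleton) : Prop :=
  ∀ δ, K.N δ = ⊤

/-- All labels are `1` or `ω`. -/
def CountableLinearSkeleton.IsQuasiMaximal (K : CountableLinearSkeleton) : Prop :=
  ∀ δ, K.N δ = 1 ∨ K.N δ = ⊤

/-! ### The four classes of topological groups -/

section Classes

variable (G : Type*) [Group G] [TopologicalSpace G]

/-- `G` is the isometry group of a Polish ultrametric Urysohn space. -/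
def IsUrysohnIsoGroup : Prop :=
  ∃ (U : Type) (_ : MetricSpace U), IsPolishUrysohn U ∧ TopIso G (U ≃ᵢ U) (isoTopology U)

/-- `G` is the isometry group of a homogeneous wide Polish ultrametric space. -/
def IsHomogeneousWideIsoGroup : Prop :=
  ∃ (U : Type) (_ : MetricSpace U), IsPolishUltrametric U ∧ IsHomogeneous U ∧ IsWide U ∧
    TopIso G (U ≃ᵢ U) (isoTopology U)

/-- `G` is a wreath product with locally finite supports over a quasi-maximal countable linear
skeleton. -/
def IsQuasiMaximalWreath : Prop :=
  ∃ K : CountableLinearSkeleton, K.IsQuasiMaximal ∧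
    TopIso G (WrSym K.N (LFSupp K.Δ)) (tau K.N (LFSupp K.Δ))

/-- `G` is a wreath product with locally finite supports, or one with finite supports and the
topology `τ*`, over a maximal countable linear skeleton. -/
def IsMaximalWreath : Prop :=
  ∃ K : CountableLinearSkeleton, K.IsMaximal ∧
    (TopIso G (WrSym K.N (LFSupp K.Δ)) (tau K.N (LFSupp K.Δ)) ∨
      TopIso G (WrSym K.N (FinSupp K.Δ)) (tauStar K.N (FinSupp K.Δ)))

end Classes

end UltrametricWreath

/-!
Label `Δ` by positive reals in a strictly increasing way, with arbitrarily small values towards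
the lower end, and let the distance of two distinct locally finite sequences be the label of the
greatest coordinate at which they differ. Isometries for this complete ultrametric are exactly the
permutations satisfying (H1), and (H2) with full symmetric groups is a consequence of (H1); so
`Wr^LF` is an isometry group. Over a quasi-maximal skeleton the space has, for each distance `r`,
a point at distance `r` from all elements of a given finite subset of an `r`-ball, because a
nontrivial coordinate takes infinitely many values. Homogeneous wide spaces have the same property.
A back-and-forth argument shows that it implies the Urysohn property, and that the complete
separable ultrametric spaces with this property are determined up to isometry by their distance
sets.

Deleting the coordinates labeled `1` from a quasi-maximal skeleton makes it maximal. If the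
remaining coordinates are coinitial, local finiteness and the topology `τ` are unaffected; if they
are bounded below, locally finite supports are finite and the cone topology is discrete, which
produces `Wr^Fin` with the topology `τ*`.
-/

namespace UltrametricWreath

/-! ### Extension of partial isometries -/

section IsometricRel

variable {X U : Type*} [PseudoMetricSpace X] [PseudoMetricSpace U] {R : SetRel X U}

/-- A relation between metric spaces that is a partial isometry: related points have the same
mutual distances. -/
def IsometricRel (R : SetRel X U) : Prop :=
  ∀ ⦃p⦄, p ∈ R → ∀ ⦃q⦄, q ∈ R → dist p.1 q.1 = dist p.2 q.2

lemma isometricRel_empty : IsometricRel (∅ : SetRel X U) :=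
  fun _ hp => hp.elim

lemma isometricRel_range {S : Type*} [PseudoMetricSpace S] {f : S → X} {g : S → U}
    (hf : Isometry f) (hg : Isometry g) : IsometricRel (Set.range fun s => (f s, g s)) := by
  rintro _ ⟨s, rfl⟩ _ ⟨t, rfl⟩
  exact (hf.dist_eq s t).trans (hg.dist_eq s t).symm

namespace IsometricRel

protected lemma inv (hR : IsometricRel R) : IsometricRel R.inv :=
  fun _ hp _ hq => (hR hp hq).symm

protected lemma insert (hR : IsometricRel R) {x : X} {u : U}
    (h : ∀ p ∈ R, dist p.1 x = dist p.2 u) : IsometricRel (insert (x, u) R) := by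
  rintro p (rfl | hp) q (rfl | hq)
  · simp only [dist_self]
  · simpa only [dist_comm] using h q hq
  · exact h p hp
  · exact hR hp hq

protected lemma closure (hR : IsometricRel R) : IsometricRel (closure R) := by
  have h_closed : IsClosed {z : (X × U) × X × U | dist z.1.1 z.2.1 = dist z.1.2 z.2.2} :=
    isClosed_eq (by fun_prop) (by fun_prop)
  have h_subset : closure (R ×ˢ R) ⊆ {z | dist z.1.1 z.2.1 = dist z.1.2 z.2.2} :=
    closure_minimal (fun z hz => hR hz.1 hz.2) h_closed
  rw [closure_prod_eq] at h_subset
  exact fun p hp q hq => h_subset (Set.mk_mem_prod hp hq)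

lemma exists_mem_closure [CompleteSpace U] (hR : IsometricRel R) (hd : Dense R.dom) (x : X) :
    ∃ u, (x, u) ∈ closure R := by
  obtain ⟨z, hz, hzx⟩ := mem_closure_iff_seq_limit.1 (hd x)
  choose v hv using hz
  have hv_cauchy : CauchySeq v := by
    refine Metric.cauchySeq_iff.2 fun ε hε => ?_
    obtain ⟨n, hn⟩ := Metric.cauchySeq_iff.1 hzx.cauchySeq ε hε
    exact ⟨n, fun i hi j hj => (hR (hv i) (hv j)).symm.trans_lt (hn i hi j hj)⟩
  obtain ⟨u, hu⟩ := cauchySeq_tendsto_of_complete hv_cauchy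
  exact ⟨u, mem_closure_of_tendsto (hzx.prodMk_nhds hu) (.of_forall hv)⟩

lemma exists_isometry [CompleteSpace U] (hR : IsometricRel R) (hd : Dense R.dom) :
    ∃ f : X → U, Isometry f ∧ ∀ x, (x, f x) ∈ closure R := by
  choose f hf using hR.exists_mem_closure hd
  exact ⟨f, .of_dist_eq fun x y => (hR.closure (hf x) (hf y)).symm, hf⟩

end IsometricRel

lemma IsometricRel.exists_isometryEquiv {X U : Type*} [MetricSpace X] [MetricSpace U]
    [CompleteSpace X] [CompleteSpace U] {R : SetRel X U} (hR : IsometricRel R)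
    (hdom : Dense R.dom) (hcod : Dense R.cod) : ∃ f : X ≃ᵢ U, ∀ p ∈ R, f p.1 = p.2 := by
  obtain ⟨f, hf_iso, hf⟩ := hR.exists_isometry hdom
  obtain ⟨g, -, hg⟩ := hR.inv.exists_isometry hcod
  have hg' : ∀ u, (g u, u) ∈ closure R := fun u => by
    have hu : (u, g u) ∈ (Homeomorph.prodComm U X) ⁻¹' closure R := by
      rw [(Homeomorph.prodComm U X).preimage_closure]
      exact hg u
    exact hu
  have h_unique : ∀ {x u}, (x, u) ∈ closure R → f x = u := fun {x u} h =>
    dist_eq_zero.1 ((hR.closure (hf x) h).symm.trans (dist_self x))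
  exact ⟨.mk' f g (fun u => h_unique (hg' u)) hf_iso, fun p hp => h_unique (subset_closure hp)⟩

end IsometricRel

section Distances

variable {U : Type*} [MetricSpace U] {r : ℝ}

lemma pos_of_mem_distanceSet (hr : r ∈ distanceSet U) : 0 < r := by
  obtain ⟨⟨x, y, rfl⟩, hne⟩ := hr
  exact dist_nonneg.lt_of_ne' hne

lemma dist_mem_distanceSet {x y : U} (h : x ≠ y) : dist x y ∈ distanceSet U :=
  ⟨⟨x, y, rfl⟩, dist_ne_zero.2 h⟩

/-- If `x'` is closer to `x` and `y'` closer to `y` than `x` is to `y`, then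
`dist x' y' = dist x y`; so the points of a dense sequence realize all distances. -/
lemma countable_distanceSet [IsUltrametricDist U] [TopologicalSpace.SeparableSpace U] :
    (distanceSet U).Countable := by
  obtain ⟨s, hs_countable, hs_dense⟩ := TopologicalSpace.exists_countable_dense U
  refine ((hs_countable.prod hs_countable).image fun p => dist p.1 p.2).mono ?_
  rintro _ ⟨⟨x, y, rfl⟩, hne⟩
  have hpos : 0 < dist x y := dist_nonneg.lt_of_ne' hne
  obtain ⟨x', hx', hxx'⟩ := hs_dense.exists_dist_lt x hpos
  obtain ⟨y', hy', hyy'⟩ := hs_dense.exists_dist_lt y hpos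
  rw [dist_comm] at hxx'
  have h₁ : dist x' y = dist x y := by
    rw [IsUltrametricDist.dist_eq_max_of_dist_ne_dist x' x y hxx'.ne, max_eq_right hxx'.le]
  have h₂ : dist x' y' = dist x' y := by
    rw [← h₁] at hyy'
    rw [IsUltrametricDist.dist_eq_max_of_dist_ne_dist x' y y' hyy'.ne', max_eq_left hyy'.le]
  exact ⟨(x', y'), ⟨hx', hy'⟩, h₂.trans h₁⟩

/-- Every finite subset of a closed ball whose radius `r` is a distance of `U` has a point at
distance `r` from all its elements. For ultrametric spaces this is the one-point extension
property behind the back-and-forth construction of isometries. -/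
def HasEquidistantPoints (U : Type*) [MetricSpace U] : Prop :=
  ∀ r ∈ distanceSet U, ∀ (a : U), ∀ A ⊆ Metric.closedBall a r, A.Finite →
    ∃ u, A ⊆ Metric.sphere u r

/-- By the ultrametric inequality, of infinitely many points at mutual distance `r` at most one
is closer than `r` to a given point of `A`. -/
lemma IsHomogeneous.hasEquidistantPoints [IsUltrametricDist U] (hU : IsHomogeneous U)
    (hw : IsWide U) : HasEquidistantPoints U := by
  intro r hr a A hA hA_fin
  obtain ⟨x, hx⟩ := hw r hr
  obtain ⟨ψ, hψ⟩ := hU (x 0) a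
  have hy : ∀ m n, m ≠ n → dist (ψ (x m)) (ψ (x n)) = r := fun m n h => by
    rw [ψ.dist_eq, hx m n h]
  have h_close : (⋃ b ∈ A, {n | dist b (ψ (x n)) < r}).Finite := by
    refine hA_fin.biUnion fun b _ => Set.Subsingleton.finite fun m hm n hn => ?_
    by_contra hmn
    refine (hy m n hmn).not_lt ((dist_triangle_max _ b _).trans_lt (max_lt ?_ hn))
    exact (dist_comm _ _).trans_lt hm
  obtain ⟨n, hn⟩ := (h_close.insert 0).exists_notMem
  simp only [Set.mem_insert_iff, Set.mem_iUnion, Set.mem_ofPred_eq, not_or, not_exists,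
    not_lt] at hn
  have ha : dist a (ψ (x n)) = r := hψ ▸ hy 0 n (Ne.symm hn.1)
  exact ⟨ψ (x n), fun b hb =>
    ((dist_triangle_max b a _).trans (max_le (hA hb) ha.le)).antisymm (hn.2 b hb)⟩

end Distances

section BackAndForth

variable {X U : Type*} [MetricSpace X] [MetricSpace U]

/-- The new image point is placed on a sphere around the image of the point of the domain
nearest to `x`; all other distances to `x` are then determined by the ultrametric inequality. -/
lemma HasEquidistantPoints.exists_isometricRel_insert [IsUltrametricDist X] [IsUltrametricDist U]
    [Nonempty U] (hU : HasEquidistantPoints U) (hD : distanceSet X ⊆ distanceSet U)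
    {R : SetRel X U} (hR_fin : R.Finite) (hR : IsometricRel R) (x : X) :
    ∃ u, IsometricRel (insert (x, u) R) := by
  suffices ∃ u, ∀ q ∈ R, dist q.1 x = dist q.2 u from this.imp fun _ => hR.insert
  rcases R.eq_empty_or_nonempty with rfl | hne
  · exact ⟨Classical.arbitrary U, fun _ hq => hq.elim⟩
  obtain ⟨p, hp, hp_min⟩ := Set.exists_min_image R (fun p => dist p.1 x) hR_fin hne
  rcases eq_or_ne p.1 x with rfl | hpx
  · exact ⟨p.2, fun q hq => hR hq hp⟩
  obtain ⟨u, hu⟩ := hU _ (hD (dist_mem_distanceSet hpx)) p.2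
    {b ∈ Prod.snd '' R | dist b p.2 ≤ dist p.1 x} (fun b hb => hb.2)
    ((hR_fin.image _).subset fun b hb => hb.1)
  have hu_dist : ∀ q ∈ R, dist q.1 p.1 ≤ dist p.1 x → dist q.2 u = dist p.1 x :=
    fun q hq hqp => hu ⟨Set.mem_image_of_mem _ hq, (hR hq hp).symm.trans_le hqp⟩
  have hpu : dist p.2 u = dist p.1 x := hu_dist p hp ((dist_self _).trans_le dist_nonneg)
  refine ⟨u, fun q hq => ?_⟩
  rcases le_or_gt (dist q.1 p.1) (dist p.1 x) with h_near | h_far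
  · rw [hu_dist q hq h_near]
    exact ((dist_triangle_max _ p.1 _).trans (max_le h_near le_rfl)).antisymm (hp_min q hq)
  · have h_far' : dist p.2 u < dist q.2 p.2 := by rwa [hpu, ← hR hq hp]
    rw [IsUltrametricDist.dist_eq_max_of_dist_ne_dist _ _ _ h_far.ne',
      IsUltrametricDist.dist_eq_max_of_dist_ne_dist _ _ _ h_far'.ne', hpu, hR hq hp]

/-- The finite partial isometries from `X` to `U`, ordered by extension. -/
abbrev FinitePartialIsometry (X U : Type*) [MetricSpace X] [MetricSpace U] : Type _ :=
  {R : SetRel X U // R.Finite ∧ IsometricRel R}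

namespace FinitePartialIsometry

variable [IsUltrametricDist X] [IsUltrametricDist U]

/-- The cofinal set of finite partial isometries whose domain contains `x`. -/
def definedAtLeft [Nonempty U] (hU : HasEquidistantPoints U)
    (hD : distanceSet X ⊆ distanceSet U) (x : X) :
    Order.Cofinal (FinitePartialIsometry X U) where
  carrier := {R | x ∈ R.1.dom}
  isCofinal R := by
    obtain ⟨u, hu⟩ := hU.exists_isometricRel_insert hD R.2.1 R.2.2 x
    exact ⟨⟨insert (x, u) R.1, R.2.1.insert _, hu⟩, ⟨u, Set.mem_insert _ _⟩,
      Set.subset_insert _ _⟩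

/-- The cofinal set of finite partial isometries whose range contains `u`. -/
def definedAtRight [Nonempty X] (hX : HasEquidistantPoints X)
    (hD : distanceSet U ⊆ distanceSet X) (u : U) :
    Order.Cofinal (FinitePartialIsometry X U) where
  carrier := {R | u ∈ R.1.cod}
  isCofinal R := by
    obtain ⟨x, hx⟩ := hX.exists_isometricRel_insert hD
      (R.2.1.preimage Prod.swap_injective.injOn) R.2.2.inv u
    have h_inv : SetRel.inv (insert (u, x) R.1.inv) = insert (x, u) R.1 := by
      ext p
      simp [SetRel.inv, Prod.ext_iff, and_comm]
    exact ⟨⟨insert (x, u) R.1, R.2.1.insert _, h_inv ▸ hx.inv⟩, ⟨x, Set.mem_insert _ _⟩,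
      Set.subset_insert _ _⟩

end FinitePartialIsometry

lemma isometricRel_sUnion_ideal (I : Order.Ideal (FinitePartialIsometry X U)) :
    IsometricRel {p : X × U | ∃ R ∈ I, p ∈ R.1} := by
  rintro p ⟨R, hR, hp⟩ q ⟨S, hS, hq⟩
  obtain ⟨T, -, hRT, hST⟩ := I.directed R hR S hS
  exact T.2.2 (hRT hp) (hST hq)

namespace HasEquidistantPoints

variable [IsUltrametricDist X] [IsUltrametricDist U] [TopologicalSpace.SeparableSpace X]
  [CompleteSpace U] [Nonempty U]

lemma exists_isometry (hU : HasEquidistantPoints U) (hD : distanceSet X ⊆ distanceSet U) :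
    ∃ f : X → U, Isometry f := by
  obtain ⟨s, hs_countable, hs_dense⟩ := TopologicalSpace.exists_countable_dense X
  let _ := hs_countable.toEncodable
  let R₀ : FinitePartialIsometry X U := ⟨∅, Set.finite_empty, isometricRel_empty⟩
  let 𝒟 (x : s) := FinitePartialIsometry.definedAtLeft hU hD x.1
  obtain ⟨f, hf, -⟩ := (isometricRel_sUnion_ideal (Order.idealOfCofinals R₀ 𝒟)).exists_isometry
    (hs_dense.mono fun x hx => by
      obtain ⟨R, ⟨u, hu⟩, hR⟩ := Order.cofinal_meets_idealOfCofinals R₀ 𝒟 ⟨x, hx⟩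
      exact ⟨u, R, hR, hu⟩)
  exact ⟨f, hf⟩

lemma exists_isometryEquiv [TopologicalSpace.SeparableSpace U] [CompleteSpace X] [Nonempty X]
    (hX : HasEquidistantPoints X) (hU : HasEquidistantPoints U)
    (hD : distanceSet X = distanceSet U) {R : SetRel X U} (hR_fin : R.Finite)
    (hR : IsometricRel R) : ∃ f : X ≃ᵢ U, ∀ p ∈ R, f p.1 = p.2 := by
  obtain ⟨s, hs_countable, hs_dense⟩ := TopologicalSpace.exists_countable_dense X
  obtain ⟨t, ht_countable, ht_dense⟩ := TopologicalSpace.exists_countable_dense U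
  let _ := hs_countable.toEncodable
  let _ := ht_countable.toEncodable
  let R₀ : FinitePartialIsometry X U := ⟨R, hR_fin, hR⟩
  let 𝒟 : s ⊕ t → Order.Cofinal (FinitePartialIsometry X U) :=
    Sum.elim (fun x => FinitePartialIsometry.definedAtLeft hU hD.le x.1)
      (fun u => FinitePartialIsometry.definedAtRight hX hD.ge u.1)
  obtain ⟨f, hf⟩ :=
    (isometricRel_sUnion_ideal (Order.idealOfCofinals R₀ 𝒟)).exists_isometryEquiv
      (hs_dense.mono fun x hx => by
        obtain ⟨S, ⟨u, hu⟩, hS⟩ := Order.cofinal_meets_idealOfCofinals R₀ 𝒟 (.inl ⟨x, hx⟩)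
        exact ⟨u, S, hS, hu⟩)
      (ht_dense.mono fun u hu => by
        obtain ⟨S, ⟨x, hx⟩, hS⟩ := Order.cofinal_meets_idealOfCofinals R₀ 𝒟 (.inr ⟨u, hu⟩)
        exact ⟨x, S, hS, hx⟩)
  exact ⟨f, fun p hp => hf p ⟨R₀, Order.mem_idealOfCofinals R₀ 𝒟, hp⟩⟩

end HasEquidistantPoints

end BackAndForth

section Urysohn

variable {U : Type*} [MetricSpace U]

lemma HasEquidistantPoints.isPolishUrysohn (hU : HasEquidistantPoints U)
    (hU' : IsPolishUltrametric U) : IsPolishUrysohn U := by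
  obtain ⟨_, _, _, _⟩ := id hU'
  refine ⟨hU', fun s f hf => ?_, fun X _ ⟨_, _, _, _⟩ hD => hU.exists_isometry hD⟩
  obtain ⟨ψ, hψ⟩ := hU.exists_isometryEquiv hU rfl (Set.finite_range fun x : s => (x.1, f x))
    (isometricRel_range isometry_subtype_coe hf)
  exact ⟨ψ, fun x => hψ (x.1, f x) ⟨x, rfl⟩⟩

lemma IsUltrahomogeneous.isHomogeneous (hU : IsUltrahomogeneous U) : IsHomogeneous U := by
  intro x y
  obtain ⟨ψ, hψ⟩ := hU {x} (fun _ => y) isometry_subsingleton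
  exact ⟨ψ, hψ ⟨x, Finset.mem_singleton_self x⟩⟩

lemma IsHomogeneous.nontrivial_isometryEquiv [Nontrivial U] (hU : IsHomogeneous U) :
    Nontrivial (U ≃ᵢ U) := by
  obtain ⟨x, y, hxy⟩ := exists_pair_ne U
  obtain ⟨ψ, hψ⟩ := hU x y
  exact ⟨ψ, 1, fun h => hxy (by rw [← hψ, h, IsometryEquiv.coe_one, id])⟩

end Urysohn

open scoped Topology

/-! ### Topological isomorphisms of permutation groups -/

section TopIso

lemma TopIso.trans {G H L : Type*} [Group G] {_ : TopologicalSpace G} [Group H] [Group L]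
    {τ : TopologicalSpace H} {σ : TopologicalSpace L} (h : TopIso G H τ) (h' : TopIso H L σ) :
    TopIso G L σ :=
  ⟨h.some.trans h'.some⟩

lemma TopIso.symm {G H : Type*} [Group G] {σ : TopologicalSpace G} [Group H]
    {τ : TopologicalSpace H} (h : TopIso G H τ) : TopIso H G σ :=
  ⟨h.some.symm⟩

lemma TopIso.nontrivial_congr {G H : Type*} [Group G] {_ : TopologicalSpace G} [Group H]
    {τ : TopologicalSpace H} (h : TopIso G H τ) : Nontrivial G ↔ Nontrivial H :=
  h.some.toEquiv.nontrivial_congr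

lemma topIso_of_equivariant {A B X Y : Type*} [Group A] [Group B] [tX : TopologicalSpace X]
    [tY : TopologicalSpace Y] (a : A → X → X) (b : B → Y → Y) (φ : X ≃ Y)
    (hφ : tX = tY.induced φ) (e : A ≃* B) (he : ∀ g x, b (e g) (φ x) = φ (a g x)) :
    @TopIso A _ (TopologicalSpace.induced a inferInstance) B _
      (TopologicalSpace.induced b inferInstance) := by
  let _ : TopologicalSpace A := TopologicalSpace.induced a inferInstance
  let _ : TopologicalSpace B := TopologicalSpace.induced b inferInstance
  let φ' : X ≃ₜ Y := φ.toHomeomorphOfIsInducing ⟨hφ⟩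
  have ha x : Continuous fun g => a g x := (continuous_apply x).comp continuous_induced_dom
  have hb y : Continuous fun g => b g y := (continuous_apply y).comp continuous_induced_dom
  have h_fun y : (fun g => b (e g) y) = fun g => φ' (a g (φ'.symm y)) := by
    funext g
    exact (congrArg (b (e g)) (φ.apply_symm_apply y)).symm.trans (he g _)
  have h_inv x : (fun g => a (e.symm g) x) = fun g => φ'.symm (b g (φ' x)) := by
    funext g
    refine φ'.eq_symm_apply.2 ((he _ x).symm.trans ?_)
    rw [e.apply_symm_apply]
    rfl
  refine ⟨{ e with continuous_toFun := ?_, continuous_invFun := ?_ }⟩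
  · exact continuous_induced_rng.2 (continuous_pi fun y =>
      (h_fun y).symm ▸ φ'.continuous.comp (ha _))
  · exact continuous_induced_rng.2 (continuous_pi fun x =>
      (h_inv x).symm ▸ φ'.symm.continuous.comp (hb _))

lemma topIso_isometryEquiv {U V : Type*} [MetricSpace U] [MetricSpace V] (φ : U ≃ᵢ V) :
    @TopIso (U ≃ᵢ U) _ (isoTopology U) (V ≃ᵢ V) _ (isoTopology V) :=
  topIso_of_equivariant (fun ψ x => ψ x) (fun ψ x => ψ x) φ.toEquiv
    φ.toHomeomorph.isInducing.eq_induced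
    { toFun := fun ψ => (φ.symm.trans ψ).trans φ
      invFun := fun ψ => (φ.trans ψ).trans φ.symm
      left_inv := fun ψ => by ext; simp
      right_inv := fun ψ => by ext; simp
      map_mul' := fun ψ χ => by ext; simp } fun ψ x => by simp

lemma topIso_pointwiseTopology {X Y : Type*} {t : TopologicalSpace X} {t' : TopologicalSpace Y}
    (φ : X ≃ Y) (hφ : t = t'.induced φ) {K : Subgroup (Equiv.Perm X)}
    {L : Subgroup (Equiv.Perm Y)} (hKL : ∀ g, g ∈ K ↔ φ.permCongrHom g ∈ L) :
    @TopIso K _ (pointwiseTopology t K) L _ (pointwiseTopology t' L) :=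
  topIso_of_equivariant (fun g x => g.1 x) (fun g y => g.1 y) φ hφ
    { toFun := fun g => ⟨φ.permCongrHom g.1, (hKL _).1 g.2⟩
      invFun := fun g => ⟨φ.permCongrHom.symm g.1,
        (hKL _).2 (by rw [MulEquiv.apply_symm_apply]; exact g.2)⟩
      left_inv := fun g => Subtype.ext (MulEquiv.symm_apply_apply _ _)
      right_inv := fun g => Subtype.ext (MulEquiv.apply_symm_apply _ _)
      map_mul' := fun g g' => Subtype.ext (map_mul _ _ _) } fun g x => by simp

end TopIso

/-! ### Generalized wreath products of full symmetric groups -/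

section Wreath

variable {Δ : Type*} {N : Δ → ℕ∞} {δ : Δ}

lemma subsingleton_coord (h : N δ = 1) : Subsingleton (Coord N δ) := by
  have h_zero (i : Coord N δ) : i.1 = 0 := by simpa [h] using i.2
  exact ⟨fun i j => Subtype.ext ((h_zero i).trans (h_zero j).symm)⟩

lemma infinite_coord (h : N δ = ⊤) : Infinite (Coord N δ) :=
  .of_injective (fun n : ℕ => ⟨n, h ▸ ENat.natCast_lt_top n⟩) fun _ _ hmn =>
    congrArg Subtype.val hmn

lemma nontrivial_coord (h₀ : N δ ≠ 0) (h₁ : N δ ≠ 1) : Nontrivial (Coord N δ) := by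
  have h : 1 < N δ := (Order.one_le_iff_ne_zero.2 h₀).lt_of_ne' h₁
  exact ⟨⟨0, zero_lt_one.trans h⟩, ⟨1, mod_cast h⟩, by simp [Subtype.ext_iff]⟩

/-- A set of sequences that is closed under changing a single coordinate. -/
def IsUpdateStable (S : Set (∀ δ, Coord N δ)) : Prop :=
  ∀ ⦃x⦄, x ∈ S → ∀ ⦃y δ⦄, (∀ γ ≠ δ, y γ = x γ) → y ∈ S

lemma IsUpdateStable.update_mem [DecidableEq Δ] {S : Set (∀ δ, Coord N δ)}
    (hS : IsUpdateStable S) {x : ∀ δ, Coord N δ} (hx : x ∈ S) (i : Coord N δ) :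
    Function.update x δ i ∈ S :=
  hS hx fun _ hγ => Function.update_of_ne hγ i x

lemma supp_subset_insert {x y : ∀ δ, Coord N δ} (h : ∀ γ ≠ δ, y γ = x γ) :
    supp y ⊆ insert δ (supp x) := by
  intro γ hγ
  rcases eq_or_ne γ δ with rfl | hne
  · exact Set.mem_insert _ _
  · exact .inr (show (x γ : ℕ) ≠ 0 from h γ hne ▸ hγ)

lemma isUpdateStable_finSupp : IsUpdateStable (domainOf N (FinSupp Δ)) :=
  fun _ hx _ δ h => (Set.Finite.insert δ hx).subset (supp_subset_insert h)

variable [PartialOrder Δ]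

lemma isUpdateStable_lfSupp : IsUpdateStable (domainOf N (LFSupp Δ)) :=
  fun _ hx _ δ h γ => ((hx γ).insert δ).subset fun _ hε =>
    (supp_subset_insert h hε.1).imp_right fun hx => ⟨hx, hε.2⟩

section AgreeAbove

variable {x y z : ∀ δ, Coord N δ}

lemma AgreeFrom.symm (h : AgreeFrom δ x y) : AgreeFrom δ y x :=
  fun γ hγ => (h γ hγ).symm

lemma AgreeFrom.trans (h : AgreeFrom δ x y) (h' : AgreeFrom δ y z) : AgreeFrom δ x z :=
  fun γ hγ => (h γ hγ).trans (h' γ hγ)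

lemma AgreeFrom.mono {ε : Δ} (hε : δ ≤ ε) (h : AgreeFrom δ x y) : AgreeFrom ε x y :=
  fun γ hγ => h γ (hε.trans hγ)

/-- The sequences `x` and `y` agree strictly above `δ`. -/
def AgreeAbove (δ : Δ) (x y : ∀ δ, Coord N δ) : Prop :=
  ∀ γ, δ < γ → x γ = y γ

lemma agreeAbove_iff_forall_agreeFrom : AgreeAbove δ x y ↔ ∀ γ, δ < γ → AgreeFrom γ x y :=
  ⟨fun h _ hγ ε hε => h ε (hγ.trans_le hε), fun h γ hγ => h γ hγ γ le_rfl⟩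

lemma agreeFrom_iff_agreeAbove_and : AgreeFrom δ x y ↔ AgreeAbove δ x y ∧ x δ = y δ := by
  refine ⟨fun h => ⟨fun γ hγ => h γ hγ.le, h δ le_rfl⟩, fun h γ hγ => ?_⟩
  rcases hγ.eq_or_lt with rfl | hγ
  exacts [h.2, h.1 γ hγ]

lemma agreeAbove_update [DecidableEq Δ] (x : ∀ δ, Coord N δ) (i : Coord N δ) :
    AgreeAbove δ (Function.update x δ i) x :=
  fun _ hγ => Function.update_of_ne hγ.ne' _ _

end AgreeAbove

lemma mem_wreath_top_iff {S : Set (∀ δ, Coord N δ)} (hS : IsUpdateStable S)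
    {g : Equiv.Perm S} : g ∈ wreath S (fun _ => ⊤) ↔
      ∀ (x y : S) (δ : Δ), AgreeFrom δ x.1 y.1 ↔ AgreeFrom δ (g x).1 (g y).1 := by
  classical
  refine ⟨fun hg => hg.1, fun hg => ⟨hg, fun x δ => ?_⟩⟩
  have h_above (y z : S) : AgreeAbove δ y.1 z.1 ↔ AgreeAbove δ (g y).1 (g z).1 := by
    simp only [agreeAbove_iff_forall_agreeFrom, hg y z]
  have h_coord (y z : S) (h : AgreeAbove δ y.1 z.1) :
      y.1 δ = z.1 δ ↔ (g y).1 δ = (g z).1 δ := by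
    simpa only [agreeFrom_iff_agreeAbove_and, h, (h_above y z).1 h, true_and] using hg y z δ
  let u (i : Coord N δ) : S := ⟨_, hS.update_mem x.2 i⟩
  have hu (i) : (u i).1 δ = i := Function.update_self δ i x.1
  have hux (i) : AgreeAbove δ (u i).1 x.1 := agreeAbove_update x.1 i
  have hu_coord (y : S) (hy : AgreeAbove δ y.1 x.1) : (g y).1 δ = (g (u (y.1 δ))).1 δ :=
    (h_coord y _ fun γ hγ => (hy γ hγ).trans (hux _ γ hγ).symm).1 (hu _).symm
  have h_bij : Function.Bijective fun i => (g (u i)).1 δ := by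
    refine ⟨fun i j hij => ?_, fun k => ?_⟩
    · rw [← hu i, ← hu j]
      exact (h_coord _ _ fun γ hγ => (hux i γ hγ).trans (hux j γ hγ).symm).2 hij
    · obtain ⟨y, hy⟩ := g.surjective ⟨_, hS.update_mem (g x).2 k⟩
      have hyx : AgreeAbove δ y.1 x.1 := (h_above y x).2 (hy ▸ agreeAbove_update (g x).1 k)
      refine ⟨y.1 δ, (hu_coord y hyx).symm.trans ?_⟩
      exact (congrArg (fun z : S => z.1 δ) hy).trans (Function.update_self δ k _)
  exact ⟨.ofBijective _ h_bij, Subgroup.mem_top _, hu_coord⟩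

end Wreath

/-! ### The cone topology -/

section ConeTopology

variable {Δ : Type*} [PartialOrder Δ] {N : Δ → ℕ∞}

lemma isOpen_induced_coneTopology {X : Type*} (f : X → ∀ δ, Coord N δ) {V : Set X}
    (hV : ∀ y ∈ V, ∃ γ, ∀ z, AgreeFrom γ (f z) (f y) → z ∈ V) :
    IsOpen[(coneTopology N).induced f] V := by
  let _ := coneTopology N
  refine ⟨⋃₀ {C | (∃ x γ, C = {z | AgreeFrom γ z x}) ∧ f ⁻¹' C ⊆ V}, isOpen_sUnion fun C hC =>
    TopologicalSpace.isOpen_generateFrom_of_mem hC.1, ?_⟩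
  rw [Set.preimage_sUnion]
  refine (Set.iUnion₂_subset fun C hC => hC.2).antisymm fun y hy => ?_
  obtain ⟨γ, hγ⟩ := hV y hy
  exact Set.mem_biUnion ⟨⟨f y, γ, rfl⟩, fun z hz => hγ z hz⟩ fun _ _ => rfl

end ConeTopology

/-! ### Removing trivial coordinates -/

lemma induced_bot_of_injective {X Y : Type*} {f : X → Y} (hf : f.Injective) :
    (⊥ : TopologicalSpace Y).induced f = ⊥ :=
  eq_bot_of_singletons_open fun x =>
    ⟨{f x}, trivial, by rw [← Set.image_singleton, hf.preimage_image]⟩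

section Restrict

variable {Δ Γ : Type*} [PartialOrder Δ] [PartialOrder Γ] {N : Δ → ℕ∞} {ι : Γ ↪o Δ}

lemma preimage_mem_lfSupp_iff (hco : ∀ δ, ∃ γ, ι γ ≤ δ) {A : Set Δ} (hA : A ⊆ Set.range ι) :
    ι ⁻¹' A ∈ LFSupp Γ ↔ A ∈ LFSupp Δ := by
  refine ⟨fun h δ => ?_, fun h γ => ?_⟩
  · obtain ⟨γ, hγ⟩ := hco δ
    refine ((h γ).image ι).subset ?_
    rintro _ ⟨hε, hδ⟩
    obtain ⟨ε, rfl⟩ := hA hε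
    exact ⟨ε, ⟨hε, ι.le_iff_le.1 (hγ.trans hδ)⟩, rfl⟩
  · exact ((h (ι γ)).preimage ι.injective.injOn).subset fun ε hε =>
      ⟨hε.1, ι.le_iff_le.2 hε.2⟩

lemma preimage_mem_finSupp_iff {β : Δ} (hβ : ∀ γ, β ≤ ι γ) {A : Set Δ}
    (hA : A ⊆ Set.range ι) : ι ⁻¹' A ∈ FinSupp Γ ↔ A ∈ LFSupp Δ := by
  have hA_above : A ⊆ {γ | β ≤ γ} := hA.trans (Set.range_subset_iff.2 hβ)
  constructor
  · exact fun h δ => (Set.finite_of_finite_preimage h hA).subset Set.inter_subset_left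
  · refine fun h => Set.Finite.preimage ι.injective.injOn ?_
    exact Set.inter_eq_left.2 hA_above ▸ h β

/-- If all coordinates outside the range of `ι` are trivial, a sequence is determined by its
restriction along `ι`. -/
noncomputable def restrictEquiv (ι : Γ ↪o Δ) (hι : ∀ δ ∉ Set.range ι, N δ = 1) :
    (∀ δ, Coord N δ) ≃ ∀ γ, Coord (fun γ => N (ι γ)) γ where
  toFun x γ := x (ι γ)
  invFun y δ := ⟨Function.extend ι (fun γ => (y γ : ℕ)) 0 δ, by
    by_cases hδ : δ ∈ Set.range ι
    · obtain ⟨γ, rfl⟩ := hδ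
      rw [ι.injective.extend_apply]
      exact (y γ).2
    · rw [Function.extend_apply' _ _ _ hδ, hι δ hδ]
      exact zero_lt_one⟩
  left_inv x := by
    funext δ
    by_cases hδ : δ ∈ Set.range ι
    · obtain ⟨γ, rfl⟩ := hδ
      exact Subtype.ext (ι.injective.extend_apply (fun γ => (x (ι γ) : ℕ)) 0 γ)
    · exact (subsingleton_coord (hι δ hδ)).elim _ _
  right_inv y := by
    funext γ
    exact Subtype.ext (ι.injective.extend_apply (fun γ => (y γ : ℕ)) 0 γ)

variable (hι : ∀ δ ∉ Set.range ι, N δ = 1)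
include hι

lemma supp_subset_range (x : ∀ δ, Coord N δ) : supp x ⊆ Set.range ι := by
  intro δ hδ
  by_contra h
  have hx : ((x δ : ℕ) : ℕ∞) < 1 := hι δ h ▸ (x δ).2
  exact hδ (by simpa using hx)

lemma agreeFrom_iff_forall_range {δ : Δ} {x y : ∀ δ, Coord N δ} :
    AgreeFrom δ x y ↔ ∀ γ, δ ≤ ι γ → x (ι γ) = y (ι γ) := by
  refine ⟨fun h γ hγ => h _ hγ, fun h ε hε => ?_⟩
  by_cases hr : ε ∈ Set.range ι
  · obtain ⟨γ, rfl⟩ := hr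
    exact h γ hε
  · exact (subsingleton_coord (hι ε hr)).elim _ _

lemma agreeFrom_restrictEquiv_iff {γ : Γ} {x y : ∀ δ, Coord N δ} :
    AgreeFrom γ (restrictEquiv ι hι x) (restrictEquiv ι hι y) ↔ AgreeFrom (ι γ) x y := by
  rw [agreeFrom_iff_forall_range hι]
  exact forall_congr' fun ε => by rw [ι.le_iff_le]; rfl

lemma agreeFrom_iff_forall_agreeFrom_restrictEquiv {δ : Δ} {x y : ∀ δ, Coord N δ} :
    AgreeFrom δ x y ↔
      ∀ γ, δ ≤ ι γ → AgreeFrom γ (restrictEquiv ι hι x) (restrictEquiv ι hι y) := by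
  simp only [agreeFrom_restrictEquiv_iff]
  refine ⟨fun h γ hγ => h.mono hγ, fun h => ?_⟩
  exact (agreeFrom_iff_forall_range hι).2 fun γ hγ => h γ hγ _ le_rfl

lemma topIso_restrict {S : Set (∀ δ, Coord N δ)} {T : Set (∀ γ, Coord (fun γ => N (ι γ)) γ)}
    (hS : IsUpdateStable S) (hT : IsUpdateStable T)
    (hST : ∀ x, x ∈ S ↔ restrictEquiv ι hι x ∈ T) {t : TopologicalSpace S}
    {t' : TopologicalSpace T} (ht : t = t'.induced ((restrictEquiv ι hι).subtypeEquiv hST)) :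
    @TopIso (wreath S fun _ => ⊤) _ (pointwiseTopology t _)
      (wreath T fun _ => ⊤) _ (pointwiseTopology t' _) := by
  refine topIso_pointwiseTopology ((restrictEquiv ι hι).subtypeEquiv hST) ht fun g => ?_
  set φ := (restrictEquiv ι hι).subtypeEquiv hST
  have hφ (x : S) : φ.permCongrHom g (φ x) = φ (g x) := by simp
  have h_agree (x y : S) (γ : Γ) : AgreeFrom γ (φ x).1 (φ y).1 ↔ AgreeFrom (ι γ) x.1 y.1 :=
    agreeFrom_restrictEquiv_iff hι
  rw [mem_wreath_top_iff hS, mem_wreath_top_iff hT]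
  constructor
  · refine fun hg => φ.surjective.forall₂.2 fun x y γ => ?_
    rw [hφ, hφ, h_agree, h_agree]
    exact hg x y (ι γ)
  · intro hg x y δ
    rw [agreeFrom_iff_forall_agreeFrom_restrictEquiv hι,
      agreeFrom_iff_forall_agreeFrom_restrictEquiv hι]
    refine forall₂_congr fun γ _ => (hg (φ x) (φ y) γ).trans ?_
    rw [hφ, hφ]
    rfl

lemma coneTopology_eq_induced_restrictEquiv (hco : ∀ δ, ∃ γ, ι γ ≤ δ) :
    coneTopology N = (coneTopology fun γ => N (ι γ)).induced (restrictEquiv ι hι) := by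
  refine le_antisymm (continuous_iff_le_induced.1 (continuous_generateFrom_iff.2 ?_))
    (le_generateFrom ?_)
  · rintro _ ⟨x, γ, rfl⟩
    obtain ⟨x, rfl⟩ := (restrictEquiv ι hι).surjective x
    refine TopologicalSpace.isOpen_generateFrom_of_mem ⟨x, ι γ, ?_⟩
    exact Set.ext fun z => agreeFrom_restrictEquiv_iff hι
  · rintro _ ⟨x, δ, rfl⟩
    refine isOpen_induced_coneTopology _ fun y hy => ?_
    obtain ⟨γ, hγ⟩ := hco δ
    exact ⟨γ, fun z hz => (((agreeFrom_restrictEquiv_iff hι).1 hz).mono hγ).trans hy⟩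

lemma coneTopology_eq_bot {β : Δ} (hβ : ∀ γ, β ≤ ι γ) : coneTopology N = ⊥ := by
  refine eq_bot_of_singletons_open fun x => ?_
  refine TopologicalSpace.isOpen_generateFrom_of_mem ⟨x, β, Set.ext fun y => ?_⟩
  refine ⟨fun h γ _ => congrFun h γ, fun h => (restrictEquiv ι hι).injective ?_⟩
  exact funext fun γ => h (ι γ) (hβ γ)

lemma topIso_restrict_of_coinitial (hco : ∀ δ, ∃ γ, ι γ ≤ δ) :
    @TopIso (WrSym N (LFSupp Δ)) _ (tau N (LFSupp Δ))
      (WrSym (fun γ => N (ι γ)) (LFSupp Γ)) _ (tau (fun γ => N (ι γ)) (LFSupp Γ)) := by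
  refine topIso_restrict hι isUpdateStable_lfSupp isUpdateStable_lfSupp
    (fun x => (preimage_mem_lfSupp_iff hco (supp_subset_range hι x)).symm) ?_
  rw [induced_compose, coneTopology_eq_induced_restrictEquiv hι hco, induced_compose]
  rfl

lemma topIso_restrict_of_bounded {β : Δ} (hβ : ∀ γ, β ≤ ι γ) :
    @TopIso (WrSym N (LFSupp Δ)) _ (tau N (LFSupp Δ))
      (WrSym (fun γ => N (ι γ)) (FinSupp Γ)) _ (tauStar (fun γ => N (ι γ)) (FinSupp Γ)) := by
  refine topIso_restrict hι isUpdateStable_lfSupp isUpdateStable_finSupp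
    (fun x => (preimage_mem_finSupp_iff hβ (supp_subset_range hι x)).symm) ?_
  rw [coneTopology_eq_bot hι hβ, induced_bot_of_injective Subtype.val_injective,
    induced_bot_of_injective (Equiv.injective _)]

end Restrict

/-! ### Scales -/

/-- A strictly increasing labeling of `Δ` by positive reals whose values below suitable elements
of `Δ` are arbitrarily small. -/
structure Scale (Δ : Type*) [Preorder Δ] where
  toFun : Δ → ℝ
  strictMono : StrictMono toFun
  pos : ∀ δ, 0 < toFun δ
  small : ∀ ε > 0, ∃ γ, ∀ δ < γ, toFun δ < ε

instance (Δ : Type*) [Preorder Δ] : CoeFun (Scale Δ) fun _ => Δ → ℝ := ⟨Scale.toFun⟩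

section Scale

variable {Δ : Type*}

lemma strictMono_tsum_indicator_Iic [Preorder Δ] {w : Δ → ℝ} (hw_pos : ∀ δ, 0 < w δ)
    (hw : Summable w) : StrictMono fun δ => ∑' γ, (Set.Iic δ).indicator w γ := by
  intro δ ε h
  refine Summable.tsum_lt_tsum (i := ε)
    (Set.indicator_le_indicator_of_subset (Set.Iic_subset_Iic.2 h.le) fun γ => (hw_pos γ).le) ?_
    (hw.indicator _) (hw.indicator _)
  simpa [h.not_ge] using hw_pos ε

lemma exists_forall_lt_tsum_indicator_Iic_lt [LinearOrder Δ] [Nonempty Δ] {w : Δ → ℝ}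
    (hw_nonneg : 0 ≤ w) (hw : Summable w) {ε : ℝ} (hε : 0 < ε) :
    ∃ γ, ∀ δ < γ, ∑' i, (Set.Iic δ).indicator w i < ε := by
  obtain ⟨s, hs⟩ := ((tendsto_tsum_compl_atTop_zero w).eventually_lt_const hε).exists
  obtain ⟨γ, hγ⟩ := s.finite_toSet.exists_ge
  refine ⟨γ, fun δ hδ => lt_of_le_of_lt ?_ ((tsum_subtype {i | i ∉ s} w).symm.trans_lt hs)⟩
  refine (hw.indicator _).tsum_le_tsum (Set.indicator_le_indicator_of_subset ?_ hw_nonneg)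
    (hw.indicator _)
  intro i hi hmem
  have hγi : γ ≤ i := hγ i hmem
  exact (hγi.trans hi).not_gt hδ

lemma nonempty_scale (Δ : Type*) [LinearOrder Δ] [Countable Δ] [Nonempty Δ] :
    Nonempty (Scale Δ) := by
  obtain ⟨_⟩ := nonempty_encodable Δ
  obtain ⟨w, hw_pos, _, hw, -⟩ := posSumOfEncodable one_pos Δ
  have hw_nonneg : 0 ≤ w := fun γ => (hw_pos γ).le
  refine ⟨⟨fun δ => ∑' γ, (Set.Iic δ).indicator w γ,
    strictMono_tsum_indicator_Iic hw_pos hw.summable, fun δ => ?_,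
    fun ε hε => exists_forall_lt_tsum_indicator_Iic_lt hw_nonneg hw.summable hε⟩⟩
  refine (hw.summable.indicator _).tsum_pos (Set.indicator_nonneg fun γ _ => hw_nonneg γ) δ ?_
  simpa using hw_pos δ

end Scale

/-! ### The ultrametric space of locally finite sequences -/

/-- The space of locally finite sequences, in which two sequences that differ at `δ` but agree
above `δ` have distance `f δ`. -/
@[ext]
structure ScaleSpace {Δ : Type*} [LinearOrder Δ] (N : Δ → ℕ∞) (f : Scale Δ) where
  seq : ∀ δ, Coord N δ
  mem_domainOf : seq ∈ domainOf N (LFSupp Δ)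

namespace ScaleSpace

variable {Δ : Type*} [LinearOrder Δ] {N : Δ → ℕ∞} {f : Scale Δ} {x y : ScaleSpace N f} {δ : Δ}

/-- The bijection with the domain of the locally finite wreath product. -/
def equivDomain : ScaleSpace N f ≃ domainOf N (LFSupp Δ) where
  toFun x := ⟨x.seq, x.mem_domainOf⟩
  invFun x := ⟨x.1, x.2⟩

lemma exists_isGreatest_ne (h : x ≠ y) : ∃ δ, IsGreatest {δ | x.seq δ ≠ y.seq δ} δ := by
  obtain ⟨δ₀, hδ₀⟩ := Function.ne_iff.1 (mt ScaleSpace.ext h)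
  have h_fin : {γ | δ₀ ≤ γ ∧ x.seq γ ≠ y.seq γ}.Finite := by
    refine ((x.mem_domainOf δ₀).union (y.mem_domainOf δ₀)).subset fun γ ⟨hγ, hne⟩ => ?_
    by_contra! h_zero
    simp only [supp, Set.mem_union, Set.mem_inter_iff, Set.mem_ofPred_eq, hγ, and_true, not_or,
      not_not] at h_zero
    exact hne (Subtype.ext (h_zero.1.trans h_zero.2.symm))
  obtain ⟨δ, ⟨hδ₀δ, hδ⟩, h_max⟩ := Set.exists_max_image _ id h_fin ⟨δ₀, le_rfl, hδ₀⟩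
  exact ⟨δ, hδ, fun γ hγ => (le_total δ₀ γ).elim (fun h => h_max γ ⟨h, hγ⟩) (·.trans hδ₀δ)⟩

lemma isGreatest_ne_iff : IsGreatest {δ | x.seq δ ≠ y.seq δ} δ ↔
    x.seq δ ≠ y.seq δ ∧ AgreeAbove δ x.seq y.seq :=
  and_congr_right fun _ => forall_congr' fun γ => by
    rw [← not_lt]
    exact not_imp_not

-- If `x ≠ y`, the supremum is a maximum; if `x = y`, it is `sSup ∅ = 0`.
noncomputable instance : Dist (ScaleSpace N f) where
  dist x y := sSup (f '' {δ | x.seq δ ≠ y.seq δ})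

lemma dist_eq_of_isGreatest (h : IsGreatest {δ | x.seq δ ≠ y.seq δ} δ) : dist x y = f δ :=
  (f.strictMono.monotone.map_isGreatest h).csSup_eq

protected lemma dist_self (x : ScaleSpace N f) : dist x x = 0 := by
  simp [dist]

protected lemma dist_nonneg (x y : ScaleSpace N f) : 0 ≤ dist x y :=
  Real.sSup_nonneg (by rintro _ ⟨δ, -, rfl⟩; exact (f.pos δ).le)

lemma dist_lt_iff : dist x y < f δ ↔ AgreeFrom δ x.seq y.seq := by
  rcases eq_or_ne x y with rfl | hne
  · exact iff_of_true ((ScaleSpace.dist_self x).trans_lt (f.pos δ)) fun _ _ => rfl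
  · obtain ⟨γ, hγ⟩ := exists_isGreatest_ne hne
    rw [dist_eq_of_isGreatest hγ, f.strictMono.lt_iff_lt]
    refine ⟨fun h ε hε => (isGreatest_ne_iff.1 hγ).2 ε (h.trans_le hε), fun h => ?_⟩
    exact not_le.1 fun hle => hγ.1 (h γ hle)

instance : IsUltrametricDist (ScaleSpace N f) where
  dist_triangle_max x y z := by
    rcases eq_or_ne x z with rfl | hne
    · exact le_max_of_le_left ((ScaleSpace.dist_self x).trans_le (ScaleSpace.dist_nonneg x y))
    · obtain ⟨γ, hγ⟩ := exists_isGreatest_ne hne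
      rw [dist_eq_of_isGreatest hγ]
      by_contra! h
      rw [max_lt_iff, dist_lt_iff, dist_lt_iff] at h
      exact hγ.1 (h.1.trans h.2 γ le_rfl)

noncomputable instance : MetricSpace (ScaleSpace N f) where
  dist_self := ScaleSpace.dist_self
  dist_comm x y := by simp only [dist, ne_comm]
  dist_triangle x y z := (IsUltrametricDist.dist_triangle_max x y z).trans
    (max_le_add_of_nonneg (ScaleSpace.dist_nonneg x y) (ScaleSpace.dist_nonneg y z))
  eq_of_dist_eq_zero {x y} h := by
    by_contra hne
    obtain ⟨γ, hγ⟩ := exists_isGreatest_ne hne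
    exact (f.pos γ).ne' ((dist_eq_of_isGreatest hγ).symm.trans h)

lemma dist_le_iff : dist x y ≤ f δ ↔ AgreeAbove δ x.seq y.seq := by
  refine ⟨fun h => ?_, fun h => ?_⟩
  · exact agreeAbove_iff_forall_agreeFrom.2 fun γ hγ =>
      dist_lt_iff.1 (h.trans_lt (f.strictMono hγ))
  · by_cases hδ : x.seq δ = y.seq δ
    · exact (dist_lt_iff.2 (agreeFrom_iff_agreeAbove_and.2 ⟨h, hδ⟩)).le
    · exact (dist_eq_of_isGreatest (isGreatest_ne_iff.2 ⟨hδ, h⟩)).le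

lemma dist_eq_iff : dist x y = f δ ↔ x.seq δ ≠ y.seq δ ∧ AgreeAbove δ x.seq y.seq := by
  rw [eq_iff_le_not_lt, dist_le_iff, dist_lt_iff, agreeFrom_iff_agreeAbove_and]
  tauto

lemma exists_dist_eq (h : x ≠ y) : ∃ δ, dist x y = f δ :=
  (exists_isGreatest_ne h).imp fun _ => dist_eq_of_isGreatest

lemma exists_forall_agreeFrom_dist_lt {ε : ℝ} (hε : 0 < ε) :
    ∃ γ, ∀ x y : ScaleSpace N f, AgreeFrom γ x.seq y.seq → dist x y < ε := by
  obtain ⟨γ, hγ⟩ := f.small ε hε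
  refine ⟨γ, fun x y hxy => ?_⟩
  rcases eq_or_ne x y with rfl | hne
  · rwa [dist_self]
  · obtain ⟨δ, hδ⟩ := exists_dist_eq hne
    rw [hδ]
    exact hγ δ (f.strictMono.lt_iff_lt.1 (hδ.symm.trans_lt (dist_lt_iff.2 hxy)))

/-! ### The isometry group as a wreath product -/

section Isometry

variable {M : Δ → ℕ∞}

lemma dist_le_dist_iff {x' y' : ScaleSpace M f} : dist x y ≤ dist x' y' ↔
    ∀ δ, AgreeFrom δ x'.seq y'.seq → AgreeFrom δ x.seq y.seq := by
  simp only [← dist_lt_iff (f := f)]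
  refine ⟨fun h δ => h.trans_lt, fun h => ?_⟩
  rcases eq_or_ne x y with rfl | hne
  · exact (dist_self x).trans_le dist_nonneg
  · obtain ⟨δ, hδ⟩ := exists_dist_eq hne
    exact hδ.trans_le (not_lt.1 fun hlt => (h δ hlt).ne hδ)

lemma isometry_iff {g : ScaleSpace N f → ScaleSpace M f} :
    Isometry g ↔ ∀ x y δ, AgreeFrom δ x.seq y.seq ↔ AgreeFrom δ (g x).seq (g y).seq := by
  rw [isometry_iff_dist_eq]
  refine forall₂_congr fun x y => ?_
  rw [le_antisymm_iff, dist_le_dist_iff, dist_le_dist_iff, ← forall_and]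
  exact forall_congr' fun δ => iff_def.symm

end Isometry

lemma topology_eq_induced_coneTopology :
    (inferInstance : TopologicalSpace (ScaleSpace N f)) = (coneTopology N).induced seq := by
  refine le_antisymm (continuous_iff_le_induced.1 (continuous_generateFrom_iff.2 ?_)) ?_
  · rintro _ ⟨x, γ, rfl⟩
    exact Metric.isOpen_iff.2 fun y hy =>
      ⟨f γ, f.pos γ, fun z hz => (dist_lt_iff.1 hz).trans hy⟩
  · refine fun V hV => isOpen_induced_coneTopology _ fun y hy => ?_
    obtain ⟨ε, hε, h_ball⟩ := Metric.isOpen_iff.1 hV y hy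
    obtain ⟨γ, hγ⟩ := exists_forall_agreeFrom_dist_lt (N := N) (f := f) hε
    exact ⟨γ, fun z hz => h_ball (hγ z y hz)⟩

theorem topIso_wreath (N : Δ → ℕ∞) (f : Scale Δ) :
    @TopIso (ScaleSpace N f ≃ᵢ ScaleSpace N f) _ (isoTopology _)
      (WrSym N (LFSupp Δ)) _ (tau N (LFSupp Δ)) := by
  have h_mem {g} := mem_wreath_top_iff (g := g) (isUpdateStable_lfSupp (N := N))
  let e : (ScaleSpace N f ≃ᵢ ScaleSpace N f) ≃* WrSym N (LFSupp Δ) :=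
    { toFun := fun ψ => ⟨equivDomain.permCongr ψ.toEquiv, h_mem.2 fun x y =>
        isometry_iff.1 ψ.isometry (equivDomain.symm x) (equivDomain.symm y)⟩
      invFun := fun g => ⟨equivDomain.symm.permCongr g.1, isometry_iff.2 fun x y =>
        h_mem.1 g.2 (equivDomain x) (equivDomain y)⟩
      left_inv := fun ψ => IsometryEquiv.ext fun _ => rfl
      right_inv := fun g => rfl
      map_mul' := fun ψ χ => rfl }
  refine topIso_of_equivariant (tY := .induced Subtype.val (coneTopology N))
    (fun ψ x => ψ x) (fun g x => g.1 x) equivDomain ?_ e fun ψ x => rfl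
  rw [induced_compose]
  exact topology_eq_induced_coneTopology

/-! ### Completeness, separability and the extension property -/

instance : CompleteSpace (ScaleSpace N f) := by
  refine Metric.complete_of_cauchySeq_tendsto fun u hu => ?_
  have h_stab (δ) : ∃ n, ∀ m ≥ n, AgreeFrom δ (u m).seq (u n).seq := by
    obtain ⟨n, hn⟩ := Metric.cauchySeq_iff'.1 hu (f δ) (f.pos δ)
    exact ⟨n, fun m hm => dist_lt_iff.1 (hn m hm)⟩
  choose n hn using h_stab
  let x (δ) : Coord N δ := (u (n δ)).seq δ
  have hx (δ) : AgreeFrom δ x (u (n δ)).seq := fun γ hγ =>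
    (hn γ _ (le_max_left _ (n δ)) γ le_rfl).symm.trans (hn δ _ (le_max_right (n γ) _) γ hγ)
  have hx_mem : x ∈ domainOf N (LFSupp Δ) := fun δ =>
    ((u (n δ)).mem_domainOf δ).subset fun γ hγ =>
      ⟨show ((u (n δ)).seq γ : ℕ) ≠ 0 from hx δ γ hγ.2 ▸ hγ.1, hγ.2⟩
  refine ⟨⟨x, hx_mem⟩, Metric.tendsto_atTop.2 fun ε hε => ?_⟩
  obtain ⟨γ, hγ⟩ := exists_forall_agreeFrom_dist_lt (N := N) (f := f) hε
  exact ⟨n γ, fun m hm => hγ _ _ ((hn γ m hm).trans (hx γ).symm)⟩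

lemma countable_setOf_finite_supp [Countable Δ] :
    {x : ScaleSpace N f | (supp x.seq).Finite}.Countable := by
  let F (x : {x : ScaleSpace N f | (supp x.seq).Finite}) : Δ →₀ ℕ :=
    .ofSupportFinite (fun δ => (x.1.seq δ : ℕ)) x.2
  have hF : Function.Injective F := fun x y h => Subtype.ext <| ScaleSpace.ext <|
    funext fun δ => Subtype.ext (DFunLike.congr_fun h δ)
  exact hF.countable

section NeZero

variable (hN : ∀ δ, N δ ≠ 0)
include hN

lemma nonempty : Nonempty (ScaleSpace N f) :=
  ⟨⟨fun δ => ⟨0, pos_iff_ne_zero.2 (hN δ)⟩, fun δ => by simp [supp]⟩⟩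

lemma dense_setOf_finite_supp : Dense {x : ScaleSpace N f | (supp x.seq).Finite} := by
  refine Metric.dense_iff.2 fun x ε hε => ?_
  obtain ⟨γ, hγ⟩ := exists_forall_agreeFrom_dist_lt (N := N) (f := f) hε
  let y (δ) : Coord N δ := if γ ≤ δ then x.seq δ else ⟨0, pos_iff_ne_zero.2 (hN δ)⟩
  have hy : (supp y).Finite := by
    refine (x.mem_domainOf γ).subset fun δ hδ => ?_
    by_cases h : γ ≤ δ
    · exact ⟨by simpa [supp, y, h] using hδ, h⟩
    · simp [supp, y, h] at hδ
  exact ⟨⟨y, fun δ => hy.subset Set.inter_subset_left⟩, hγ _ _ fun δ hδ => if_pos hδ, hy⟩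

lemma isPolishUltrametric [Countable Δ] : IsPolishUltrametric (ScaleSpace N f) where
  nonempty := nonempty hN
  ultrametric := inferInstance
  complete := inferInstance
  secondCountable :=
    have : TopologicalSpace.SeparableSpace (ScaleSpace N f) :=
      ⟨_, countable_setOf_finite_supp, dense_setOf_finite_supp hN⟩
    UniformSpace.secondCountable_of_separable _

lemma mem_distanceSet_iff {r : ℝ} :
    r ∈ distanceSet (ScaleSpace N f) ↔ ∃ δ, N δ ≠ 1 ∧ f δ = r := by
  classical
  constructor
  · rintro ⟨⟨x, y, rfl⟩, hne⟩
    obtain ⟨δ, hδ⟩ := exists_isGreatest_ne (dist_ne_zero.1 hne)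
    exact ⟨δ, fun h => hδ.1 ((subsingleton_coord h).elim _ _), (dist_eq_of_isGreatest hδ).symm⟩
  · rintro ⟨δ, hδ, rfl⟩
    obtain ⟨x⟩ := nonempty (f := f) hN
    have := nontrivial_coord (hN δ) hδ
    obtain ⟨i, hi⟩ := exists_ne (x.seq δ)
    have h_dist : dist (⟨_, isUpdateStable_lfSupp.update_mem x.mem_domainOf i⟩ : ScaleSpace N f) x =
        f δ := dist_eq_iff.2 ⟨ne_of_eq_of_ne (Function.update_self ..) hi, agreeAbove_update _ _⟩
    exact ⟨⟨_, _, h_dist⟩, (f.pos δ).ne'⟩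

end NeZero

lemma exists_subset_sphere (hδ : N δ = ⊤) (a : ScaleSpace N f) {A : Set (ScaleSpace N f)}
    (hA : A ⊆ Metric.closedBall a (f δ)) (hA_fin : A.Finite) :
    ∃ u, A ⊆ Metric.sphere u (f δ) := by
  classical
  have := infinite_coord hδ
  obtain ⟨i, hi⟩ := (hA_fin.image fun b => b.seq δ).exists_notMem
  refine ⟨⟨_, isUpdateStable_lfSupp.update_mem a.mem_domainOf i⟩, fun b hb => ?_⟩
  refine dist_eq_iff.2 ⟨fun h => hi ⟨b, hb, h.trans (Function.update_self δ i a.seq)⟩, ?_⟩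
  exact fun γ hγ => (dist_le_iff.1 (hA hb) γ hγ).trans (agreeAbove_update a.seq i γ hγ).symm

lemma hasEquidistantPoints (hN : ∀ δ, N δ = 1 ∨ N δ = ⊤) :
    HasEquidistantPoints (ScaleSpace N f) := by
  intro r hr a A hA hA_fin
  have hN_ne_zero (δ) : N δ ≠ 0 := by rcases hN δ with h | h <;> simp [h]
  obtain ⟨δ, hδ, rfl⟩ := (mem_distanceSet_iff hN_ne_zero).1 hr
  exact exists_subset_sphere ((hN δ).resolve_left hδ) a hA hA_fin

end ScaleSpace

/-! ### The equivalences -/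

lemma IsUniversal.isWide {U : Type*} [MetricSpace U] (hU : IsUniversal U) : IsWide U := by
  intro r hr
  let f : Scale Unit := ⟨fun _ => r, Subsingleton.strictMono _,
    fun _ => pos_of_mem_distanceSet hr, fun _ _ => ⟨(), fun _ h => (lt_irrefl _ h).elim⟩⟩
  let N : Unit → ℕ∞ := fun _ => ⊤
  have hN (δ) : N δ ≠ 0 := ENat.top_ne_zero
  obtain ⟨φ, hφ⟩ := hU (ScaleSpace N f) (ScaleSpace.isPolishUltrametric hN) fun q hq => by
    obtain ⟨_, -, rfl⟩ := (ScaleSpace.mem_distanceSet_iff hN).1 hq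
    exact hr
  have := infinite_coord (N := N) (δ := ()) rfl
  let x (n : ℕ) : ScaleSpace N f :=
    ⟨fun _ => Infinite.natEmbedding (Coord N ()) n, fun _ => Set.toFinite _⟩
  refine ⟨fun n => φ (x n), fun m n hmn => (hφ.dist_eq _ _).trans ?_⟩
  exact ScaleSpace.dist_eq_iff (f := f) (δ := ()) |>.2
    ⟨(Infinite.natEmbedding _).injective.ne hmn, fun _ h => (lt_irrefl _ h).elim⟩

namespace CountableLinearSkeleton

variable {K : CountableLinearSkeleton}

lemma exists_isQuasiMaximal_distanceSet_eq {D : Set ℝ} (hD_countable : D.Countable)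
    (hD_pos : ∀ r ∈ D, 0 < r) : ∃ K : CountableLinearSkeleton, K.IsQuasiMaximal ∧
      ∃ f : Scale K.Δ, distanceSet (ScaleSpace K.N f) = D := by
  classical
  -- The values of the scale must tend to `0`, so `D` is padded with trivially labeled rationals.
  let E : Set ℝ := {r | 0 < r ∧ (r ∈ D ∨ r ∈ Set.range ((↑) : ℚ → ℝ))}
  have : Countable E :=
    ((hD_countable.union (Set.countable_range _)).mono fun r hr => hr.2).to_subtype
  have : Nonempty E := ⟨1, one_pos, .inr ⟨1, Rat.cast_one⟩⟩
  let f : Scale E :=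
    { toFun := Subtype.val
      strictMono := Subtype.strictMono_coe _
      pos := fun r => r.2.1
      small := fun ε hε => by
        obtain ⟨q, hq_pos, hq⟩ := exists_rat_btwn hε
        exact ⟨⟨q, hq_pos, .inr ⟨q, rfl⟩⟩, fun r hr => lt_trans hr hq⟩ }
  let N (r : E) : ℕ∞ := if r.1 ∈ D then ⊤ else 1
  have hN (r) : N r ≠ 0 := by unfold N; split_ifs <;> simp
  refine ⟨⟨E, N, hN⟩, fun r => (ite_eq_or_eq _ _ _).symm, f, Set.ext fun r => ?_⟩
  rw [ScaleSpace.mem_distanceSet_iff hN]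
  constructor
  · rintro ⟨r, hr, rfl⟩
    exact not_not.1 fun h => hr (if_neg h)
  · exact fun hr => ⟨⟨r, hD_pos r hr, .inl hr⟩, by simp [N, hr], rfl⟩

lemma IsQuasiMaximal.isPolishUrysohn (hK : K.IsQuasiMaximal) (f : Scale K.Δ) :
    IsPolishUrysohn (ScaleSpace K.N f) :=
  (ScaleSpace.hasEquidistantPoints hK).isPolishUrysohn
    (ScaleSpace.isPolishUltrametric K.N_ne_zero)

lemma IsQuasiMaximal.nontrivial_wrSym_iff (hK : K.IsQuasiMaximal) :
    Nontrivial (WrSym K.N (LFSupp K.Δ)) ↔ ∃ δ, K.N δ = ⊤ := by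
  refine ⟨fun h => ?_, fun ⟨δ, hδ⟩ => ?_⟩
  · by_contra! h_ne
    have h_coord (δ) : Subsingleton (Coord K.N δ) :=
      subsingleton_coord ((hK δ).resolve_right (h_ne δ))
    exact not_subsingleton (WrSym K.N (LFSupp K.Δ)) inferInstance
  · obtain ⟨f⟩ := nonempty_scale K.Δ
    have h_dist : f δ ∈ distanceSet (ScaleSpace K.N f) :=
      (ScaleSpace.mem_distanceSet_iff K.N_ne_zero).2 ⟨δ, by simp [hδ], rfl⟩
    obtain ⟨⟨x, y, hxy⟩, hne⟩ := h_dist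
    have : Nontrivial (ScaleSpace K.N f) := ⟨x, y, dist_ne_zero.1 (hxy ▸ hne)⟩
    have := (hK.isPolishUrysohn f).ultrahomogeneous.isHomogeneous.nontrivial_isometryEquiv
    exact (ScaleSpace.topIso_wreath K.N f).some.toEquiv.symm.nontrivial

/-- The skeleton `K` with a new least element labeled `1`, which turns the finite subsets of `K`
into locally finite ones. -/
def addBot (K : CountableLinearSkeleton) : CountableLinearSkeleton where
  Δ := WithBot K.Δ
  countable := inferInstanceAs (Countable (Option K.Δ))
  N := WithBot.recBotCoe (C := fun _ => ℕ∞) 1 K.N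
  N_ne_zero := WithBot.forall.2 ⟨one_ne_zero, K.N_ne_zero⟩

lemma IsQuasiMaximal.addBot (hK : K.IsQuasiMaximal) : K.addBot.IsQuasiMaximal :=
  WithBot.forall.2 ⟨.inl rfl, hK⟩

lemma topIso_addBot (K : CountableLinearSkeleton) :
    @TopIso (WrSym K.addBot.N (LFSupp K.addBot.Δ)) _ (tau K.addBot.N (LFSupp K.addBot.Δ))
      (WrSym K.N (FinSupp K.Δ)) _ (tauStar K.N (FinSupp K.Δ)) :=
  topIso_restrict_of_bounded (N := K.addBot.N) (ι := WithBot.coeOrderHom) (β := (⊥ : WithBot K.Δ))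
    (WithBot.forall.2 ⟨fun _ => rfl, fun δ hδ => (hδ ⟨δ, rfl⟩).elim⟩)
    fun _ => bot_le (α := WithBot K.Δ)

/-- The part of a skeleton where the label is `ω`. -/
def infinitePart (K : CountableLinearSkeleton) (hK : ∃ δ, K.N δ = ⊤) :
    CountableLinearSkeleton where
  Δ := {δ : K.Δ // K.N δ = ⊤}
  nonempty := nonempty_subtype.2 hK
  N δ := K.N δ
  N_ne_zero δ := K.N_ne_zero δ

lemma isMaximal_infinitePart (hK : ∃ δ, K.N δ = ⊤) : (K.infinitePart hK).IsMaximal :=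
  Subtype.property

lemma IsQuasiMaximal.topIso_infinitePart (hK : K.IsQuasiMaximal) (hK' : ∃ δ, K.N δ = ⊤) :
    let L := K.infinitePart hK'
    @TopIso (WrSym K.N (LFSupp K.Δ)) _ (tau K.N (LFSupp K.Δ))
        (WrSym L.N (LFSupp L.Δ)) _ (tau L.N (LFSupp L.Δ)) ∨
      @TopIso (WrSym K.N (LFSupp K.Δ)) _ (tau K.N (LFSupp K.Δ))
        (WrSym L.N (FinSupp L.Δ)) _ (tauStar L.N (FinSupp L.Δ)) := by
  let ι : {δ : K.Δ // K.N δ = ⊤} ↪o K.Δ := OrderEmbedding.subtype _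
  have hι : ∀ δ ∉ Set.range ι, K.N δ = 1 := fun δ hδ =>
    (hK δ).resolve_right fun h => hδ ⟨⟨δ, h⟩, rfl⟩
  by_cases hco : ∀ δ, ∃ γ, ι γ ≤ δ
  · exact .inl (topIso_restrict_of_coinitial hι hco)
  · push Not at hco
    obtain ⟨β, hβ⟩ := hco
    exact .inr (topIso_restrict_of_bounded hι fun γ => (hβ γ).le)

end CountableLinearSkeleton

section Equivalences

variable {G : Type*} [Group G] [TopologicalSpace G]

lemma IsUrysohnIsoGroup.isHomogeneousWideIsoGroup (h : IsUrysohnIsoGroup G) :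
    IsHomogeneousWideIsoGroup G := by
  obtain ⟨U, _, hU, hG⟩ := h
  exact ⟨U, _, hU.polishUltrametric, hU.ultrahomogeneous.isHomogeneous, hU.universal.isWide, hG⟩

lemma IsHomogeneousWideIsoGroup.isQuasiMaximalWreath (h : IsHomogeneousWideIsoGroup G) :
    IsQuasiMaximalWreath G := by
  obtain ⟨U, _, ⟨_, _, _, _⟩, h_hom, h_wide, hG⟩ := h
  obtain ⟨K, hK, f, hf⟩ := CountableLinearSkeleton.exists_isQuasiMaximal_distanceSet_eq
    (countable_distanceSet (U := U)) fun _ => pos_of_mem_distanceSet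
  obtain ⟨_, _, _, _⟩ := ScaleSpace.isPolishUltrametric (f := f) K.N_ne_zero
  obtain ⟨φ, -⟩ := (h_hom.hasEquidistantPoints h_wide).exists_isometryEquiv
    (ScaleSpace.hasEquidistantPoints (f := f) hK) hf.symm Set.finite_empty isometricRel_empty
  exact ⟨K, hK, hG.trans ((topIso_isometryEquiv φ).trans (ScaleSpace.topIso_wreath K.N f))⟩

lemma IsQuasiMaximalWreath.isUrysohnIsoGroup (h : IsQuasiMaximalWreath G) :
    IsUrysohnIsoGroup G := by
  obtain ⟨K, hK, hG⟩ := h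
  obtain ⟨f⟩ := nonempty_scale K.Δ
  exact ⟨_, _, hK.isPolishUrysohn f, hG.trans (ScaleSpace.topIso_wreath K.N f).symm⟩

lemma isMaximalWreath_iff : IsMaximalWreath G ↔ IsQuasiMaximalWreath G ∧ Nontrivial G := by
  refine ⟨fun ⟨K, hK, hG⟩ => ?_, fun ⟨⟨K, hK, hG⟩, h_nontrivial⟩ => ?_⟩
  · have hK' : K.IsQuasiMaximal := fun δ => .inr (hK δ)
    obtain ⟨δ⟩ := K.nonempty
    rcases hG with hG | hG
    · exact ⟨⟨K, hK', hG⟩, hG.nontrivial_congr.2 (hK'.nontrivial_wrSym_iff.2 ⟨δ, hK δ⟩)⟩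
    · have hG' := hG.trans K.topIso_addBot.symm
      exact ⟨⟨K.addBot, hK'.addBot, hG'⟩,
        hG'.nontrivial_congr.2 (hK'.addBot.nontrivial_wrSym_iff.2 ⟨WithBot.some δ, hK δ⟩)⟩
  · have hK' := hK.nontrivial_wrSym_iff.1 (hG.nontrivial_congr.1 h_nontrivial)
    exact ⟨K.infinitePart hK', CountableLinearSkeleton.isMaximal_infinitePart hK',
      (hK.topIso_infinitePart hK').imp hG.trans hG.trans⟩

end Equivalences
end UltrametricWreath

theorem mainTheorem5 {G : Type*} [Group G] [TopologicalSpace G] [IsTopologicalGroup G] :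
    List.TFAE
      [UltrametricWreath.IsUrysohnIsoGroup G,
        UltrametricWreath.IsHomogeneousWideIsoGroup G,
        UltrametricWreath.IsQuasiMaximalWreath G] ∧
    (UltrametricWreath.IsMaximalWreath G ↔
      UltrametricWreath.IsUrysohnIsoGroup G ∧ Nontrivial G) := by
  have h_tfae : List.TFAE [UltrametricWreath.IsUrysohnIsoGroup G,
      UltrametricWreath.IsHomogeneousWideIsoGroup G,
      UltrametricWreath.IsQuasiMaximalWreath G] := by
    tfae_have 1 → 2 := fun h => h.isHomogeneousWideIsoGroup
    tfae_have 2 → 3 := fun h => h.isQuasiMaximalWreath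
    tfae_have 3 → 1 := fun h => h.isUrysohnIsoGroup
    tfae_finish
  exact ⟨h_tfae, UltrametricWreath.isMaximalWreath_iff.trans
    (and_congr_left' (h_tfae.out 2 0))⟩
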